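/- Let $G$ be a group with a finite set of generators $A = A^{-1}\subset G$, and let $\Gamma$ be its Cayley graph with respect to $A$, with vertex set $G$, edges of length $1$ from $g$ to $ga$ ($a\in A$), and path metric $d$. For a word $w$ over $A$ write $\ell(w)$ for its length, $w(t)$ for its prefix of length $t$ and $\overline{w}\in G$ for the element it represents; for $r\le s\le \ell(w)$ let $\overline{w(r,s)}$ be the subpath from $\overline{w(r)}$ to $\overline{w(s)}$ of the path in $\Gamma$ that starts at the identity and is labelled by $w$. An automatic structure on $G$ over $A$ consists of a finite state automaton $W$ over $A$ (the word acceptor) and finite state automata $M_x$, $x\in A\cup\{\varepsilon\}$ (the compare automata), over $(A\cup\{\$\})\times(A\cup\{\$\})$, where $\varepsilon$ is the identity of $G$ and $\$\notin A$, such that every element of $G$ equals $\overline{w}$ for some word $w\in L(W)$, the set of words accepted by $W$; and such that for all words $w,w'$ over $A$ the pair $(w,w')$, read letter by letter in parallel with the shorter word padded at its end by $\$$, is accepted by $M_x$ if and only if $\overline{w}\,x=\overline{w'}$ and $w,w'\in L(W)$. The structure is weakly geodesic if every $w\in L(W)$ is geodesic, that is, $\ell(w)=d(\varepsilon,\overline{w})$;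 it is prefix closed if every prefix of a word of $L(W)$ is in $L(W)$; it has the uniqueness property if $w\mapsto\overline{w}$ is injective on $L(W)$. For $n>0$, $n$-tracks of length $n$ are $n$ mutually disjoint paths $t_1,\dots,t_n$ of length $n$ in $\Gamma$ for which there are words $w_1,w_1',\dots,w_n,w_n'\in L(W)$, each of length at least $r+n$, where $r$ is a positive integer, such that $t_i=\overline{w_i(r,r+n)}=\overline{w_i'(r,r+n)}$ for $1\le i\le n$, and such that for each $1\le i\le n-1$ the pair $(w_i',w_{i+1})$ is accepted by $M_x$ for some $x\in A\cup\{\varepsilon\}$. **Theorem.** Suppose that $G$ has an automatic structure over $A$ that is weakly geodesic, prefix closed and has the uniqueness property. If $G$ is not word hyperbolic, that is, if there is no $\delta>0$ such that in every geodesic triangle in $\Gamma$ each point of a side is at distance at most $\delta$ from the union of the other two sides, then for every $n>0$ there exist $n$-tracks of length $n$ in $\Gamma$ for this automatic structure. -/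

import Mathlib

/-! ### Hyperbolic spaces -/

/-- `σ` is (the image of) a geodesic from `x` to `y`. -/
def IsGeodesicSegment {X : Type*} [PseudoMetricSpace X] (x y : X) (σ : Set X) : Prop :=
  ∃ γ : ℝ → X, γ 0 = x ∧ γ (dist x y) = y ∧
    (∀ s ∈ Set.Icc 0 (dist x y), ∀ t ∈ Set.Icc 0 (dist x y), dist (γ s) (γ t) = |s - t|) ∧
    σ = γ '' Set.Icc 0 (dist x y)

/-- Gromov hyperbolicity: there is `δ > 0` such that in every geodesic triangle each point of a
side is within `δ` of the union of the other two sides. (All sides are covered, as the vertices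
may be permuted cyclically.) -/
def IsHyperbolicSpace (X : Type*) [PseudoMetricSpace X] : Prop :=
  ∃ δ : ℝ, 0 < δ ∧ ∀ (x y z : X) (a b c : Set X),
    IsGeodesicSegment x y a → IsGeodesicSegment y z b → IsGeodesicSegment z x c →
      ∀ u ∈ a, ∃ v ∈ b ∪ c, dist u v ≤ δ

/-! ### The metric realization of a graph -/

/-- A point of the geometric realization of a simple graph: the point at distance `t` from `src`
on the unit length edge between `src` and `tgt`, or the vertex `src` itself (`src = tgt`, `t = 0`).
A geometric point may have several such descriptions; they are at distance `0` from each other. -/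
structure GraphPoint {V : Type*} (Γ : SimpleGraph V) where
  src : V
  tgt : V
  t : ℝ
  t_nonneg : 0 ≤ t
  t_le_one : t ≤ 1
  adj_or_vertex : Γ.Adj src tgt ∨ (src = tgt ∧ t = 0)

namespace GraphPoint

/-- The two ends of the edge carrying `p`. -/
def vert {V : Type*} {Γ : SimpleGraph V} (p : GraphPoint Γ) (e : Bool) : V :=
  if e then p.tgt else p.src

/-- The distances from `p` to the two ends of its edge, along the edge. -/
def offset {V : Type*} {Γ : SimpleGraph V} (p : GraphPoint Γ) (e : Bool) : ℝ :=
  if e then 1 - p.t else p.t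

/-- The length of the shortest path from `p` to `q` that leaves the edge of `p` at its end `e` and
enters the edge of `q` at its end `f`. -/
noncomputable def via {V : Type*} {Γ : SimpleGraph V} (p q : GraphPoint Γ) (e f : Bool) : ℝ :=
  p.offset e + (Γ.dist (p.vert e) (q.vert f) : ℝ) + q.offset f

open Classical in
/-- The path metric: on a common edge it is the metric of the unit interval, otherwise a shortest
path passes through an end of each of the two edges. -/
noncomputable def pathDist {V : Type*} {Γ : SimpleGraph V} (p q : GraphPoint Γ) : ℝ :=
  if p.src = q.src ∧ p.tgt = q.tgt then |p.t - q.t|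
  else if p.src = q.tgt ∧ p.tgt = q.src then |p.t - (1 - q.t)|
  else min (min (via p q false false) (via p q false true))
    (min (via p q true false) (via p q true true))

variable {V : Type*} {Γ : SimpleGraph V}

theorem offset_nonneg (p : GraphPoint Γ) (e : Bool) : 0 ≤ p.offset e := by
  have h0 := p.t_nonneg
  have h1 := p.t_le_one
  cases e <;> simp [offset, h0, h1]

theorem via_comm (p q : GraphPoint Γ) (e f : Bool) : via p q e f = via q p f e := by
  simp only [via, SimpleGraph.dist_comm (u := p.vert e)]
  ring

theorem pathDist_comm (p q : GraphPoint Γ) : pathDist p q = pathDist q p := by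
  unfold pathDist
  by_cases h1 : p.src = q.src ∧ p.tgt = q.tgt
  · rw [if_pos h1, if_pos ⟨h1.1.symm, h1.2.symm⟩, abs_sub_comm]
  · have h1' : ¬ (q.src = p.src ∧ q.tgt = p.tgt) := fun h => h1 ⟨h.1.symm, h.2.symm⟩
    rw [if_neg h1, if_neg h1']
    by_cases h2 : p.src = q.tgt ∧ p.tgt = q.src
    · rw [if_pos h2, if_pos ⟨h2.2.symm, h2.1.symm⟩]
      congr 1
      ring
    · have h2' : ¬ (q.src = p.tgt ∧ q.tgt = p.src) := fun h => h2 ⟨h.2.symm, h.1.symm⟩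
      rw [if_neg h2, if_neg h2', via_comm p q, via_comm p q,
        via_comm p q, via_comm p q]
      rw [min_min_min_comm]

/-- The edges of `p` and `q` have the same ends, and `m` is the position of `q` seen from
`p.src`. -/
def SameEdge (p q : GraphPoint Γ) (m : ℝ) : Prop :=
  (p.src = q.src ∧ p.tgt = q.tgt ∧ m = q.t) ∨
    (Γ.Adj p.src p.tgt ∧ p.src = q.tgt ∧ p.tgt = q.src ∧ m = 1 - q.t)

theorem pathDist_cases (p q : GraphPoint Γ) :
    (∃ m, SameEdge p q m ∧ pathDist p q = |p.t - m|) ∨ ∃ e f, pathDist p q = via p q e f := by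
  unfold pathDist
  by_cases h1 : p.src = q.src ∧ p.tgt = q.tgt
  · rw [if_pos h1]
    exact Or.inl ⟨_, Or.inl ⟨h1.1, h1.2, rfl⟩, rfl⟩
  · rw [if_neg h1]
    by_cases h2 : p.src = q.tgt ∧ p.tgt = q.src
    · rw [if_pos h2]
      refine Or.inl ⟨_, Or.inr ⟨?_, h2.1, h2.2, rfl⟩, rfl⟩
      rcases p.adj_or_vertex with h | h
      · exact h
      · exact absurd ⟨h.1.trans h2.2, h.1.symm.trans h2.1⟩ h1
    · rw [if_neg h2]
      right
      rcases min_choice (min (via p q false false) (via p q false true))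
        (min (via p q true false) (via p q true true)) with h | h <;> rw [h]
      · rcases min_choice (via p q false false) (via p q false true) with h | h <;>
          exact ⟨_, _, h⟩
      · rcases min_choice (via p q true false) (via p q true true) with h | h <;>
          exact ⟨_, _, h⟩

theorem SameEdge.pathDist_eq {p q : GraphPoint Γ} {m : ℝ} (h : SameEdge p q m) :
    pathDist p q = |p.t - m| := by
  unfold pathDist
  rcases h with ⟨h1, h2, rfl⟩ | ⟨ha, h1, h2, rfl⟩
  · rw [if_pos ⟨h1, h2⟩]
  · rw [if_neg, if_pos ⟨h1, h2⟩]
    rintro ⟨h3, -⟩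
    exact ha.ne (h3.trans h2.symm)

theorem pathDist_le_via (p q : GraphPoint Γ) (e f : Bool) : pathDist p q ≤ via p q e f := by
  have hp0 := p.t_nonneg
  have hp1 := p.t_le_one
  have hq0 := q.t_nonneg
  have hq1 := q.t_le_one
  unfold pathDist
  by_cases h1 : p.src = q.src ∧ p.tgt = q.tgt
  · rw [if_pos h1]
    rcases p.adj_or_vertex with h | h
    · have h' : Γ.dist q.src q.tgt = 1 := by
        rw [← h1.1, ← h1.2]
        exact SimpleGraph.dist_eq_one_iff_adj.2 h
      have h'' : Γ.dist q.tgt q.src = 1 := by rw [SimpleGraph.dist_comm, h']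
      cases e <;> cases f <;> simp [via, vert, offset, h1.1, h1.2, h', h''] <;>
        rw [abs_le] <;> constructor <;> linarith
    · have ht : q.t = 0 := by
        rcases q.adj_or_vertex with h' | h'
        · exact absurd (h1.1.symm.trans (h.1.trans h1.2)) h'.ne
        · exact h'.2
      rw [h.2, ht, sub_zero, abs_zero]
      exact add_nonneg (add_nonneg (p.offset_nonneg e) (Nat.cast_nonneg _)) (q.offset_nonneg f)
  · rw [if_neg h1]
    by_cases h2 : p.src = q.tgt ∧ p.tgt = q.src
    · rw [if_pos h2]
      rcases p.adj_or_vertex with h | h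
      · have h' : Γ.dist q.tgt q.src = 1 := by
          rw [← h2.1, ← h2.2]
          exact SimpleGraph.dist_eq_one_iff_adj.2 h
        have h'' : Γ.dist q.src q.tgt = 1 := by rw [SimpleGraph.dist_comm, h']
        cases e <;> cases f <;> simp [via, vert, offset, h2.1, h2.2, h', h''] <;>
          rw [abs_le] <;> constructor <;> linarith
      · exact absurd ⟨h.1.trans h2.2, h.1.symm.trans h2.1⟩ h1
    · rw [if_neg h2]
      cases e <;> cases f
      · exact (min_le_left _ _).trans (min_le_left _ _)
      · exact (min_le_left _ _).trans (min_le_right _ _)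
      · exact (min_le_right _ _).trans (min_le_left _ _)
      · exact (min_le_right _ _).trans (min_le_right _ _)

/-- Moving along an edge changes the distances to its ends by at most the length of the move. -/
theorem SameEdge.exists_offset_le {p q : GraphPoint Γ} {m : ℝ} (h : SameEdge p q m) (e : Bool) :
    ∃ f, p.vert f = q.vert e ∧ p.offset f ≤ |p.t - m| + q.offset e := by
  have h1 := le_abs_self (p.t - m)
  have h2 := neg_abs_le (p.t - m)
  rcases h with ⟨hs, ht, rfl⟩ | ⟨-, hs, ht, rfl⟩
  · refine ⟨e, ?_, ?_⟩ <;> cases e <;> simp [vert, offset, hs, ht] <;> linarith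
  · refine ⟨!e, ?_, ?_⟩ <;> cases e <;> simp [vert, offset, hs, ht] <;> linarith

theorem dist_vert_le (p : GraphPoint Γ) (e f : Bool) :
    (Γ.dist (p.vert e) (p.vert f) : ℝ) ≤ p.offset e + p.offset f := by
  have h0 := p.t_nonneg
  have h1 := p.t_le_one
  have hd : Γ.dist p.src p.tgt ≤ 1 := by
    rcases p.adj_or_vertex with h | h
    · exact (SimpleGraph.dist_eq_one_iff_adj.2 h).le
    · rw [h.1]
      simp
  have hd' : (Γ.dist p.src p.tgt : ℝ) ≤ 1 := by exact_mod_cast hd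
  have hd'' : (Γ.dist p.tgt p.src : ℝ) ≤ 1 := by rwa [SimpleGraph.dist_comm]
  cases e <;> cases f <;> simp only [vert, offset, SimpleGraph.dist_self, Nat.cast_zero, if_true,
    Bool.false_eq_true, if_false] <;> linarith

theorem pathDist_triangle_aux (hΓ : Γ.Connected) (p q r : GraphPoint Γ) (e f : Bool) :
    pathDist p r ≤ pathDist p q + via q r e f := by
  rcases pathDist_cases p q with ⟨m, hm, h⟩ | ⟨g, k, h⟩ <;> rw [h]
  · obtain ⟨k, hk, hk'⟩ := hm.exists_offset_le e
    refine (pathDist_le_via p r k f).trans ?_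
    unfold via
    rw [hk]
    linarith
  · refine (pathDist_le_via p r g f).trans ?_
    have h1 := dist_vert_le q k e
    have h2 : (Γ.dist (p.vert g) (r.vert f) : ℝ) ≤ Γ.dist (p.vert g) (q.vert k) +
        Γ.dist (q.vert k) (q.vert e) + Γ.dist (q.vert e) (r.vert f) := by
      exact_mod_cast (hΓ.dist_triangle (v := q.vert e)).trans
        (Nat.add_le_add_right (hΓ.dist_triangle (v := q.vert k)) _)
    unfold via
    linarith

theorem pathDist_triangle (hΓ : Γ.Connected) (p q r : GraphPoint Γ) :
    pathDist p r ≤ pathDist p q + pathDist q r := by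
  rcases pathDist_cases q r with ⟨m, hm, h⟩ | ⟨e, f, h⟩
  · rcases pathDist_cases p q with ⟨l, hl, h'⟩ | ⟨e, f, h'⟩
    · have key : ∃ k, SameEdge p r k ∧ |l - k| = |q.t - m| := by
        rcases hl with ⟨a1, a2, rfl⟩ | ⟨a0, a1, a2, rfl⟩ <;>
          rcases hm with ⟨b1, b2, rfl⟩ | ⟨b0, b1, b2, rfl⟩
        · exact ⟨_, Or.inl ⟨a1.trans b1, a2.trans b2, rfl⟩, rfl⟩
        · exact ⟨_, Or.inr ⟨by rw [a1, a2]; exact b0, a1.trans b1, a2.trans b2, rfl⟩, rfl⟩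
        · refine ⟨_, Or.inr ⟨a0, a1.trans b2, a2.trans b1, rfl⟩, ?_⟩
          rw [← abs_neg]
          congr 1
          ring
        · refine ⟨_, Or.inl ⟨a1.trans b2, a2.trans b1, rfl⟩, ?_⟩
          rw [← abs_neg]
          congr 1
          ring
      obtain ⟨k, hk, hk'⟩ := key
      rw [hk.pathDist_eq, h, h', ← hk']
      exact abs_sub_le _ _ _
    · have := pathDist_triangle_aux hΓ r q p f e
      rw [via_comm q p, ← h'] at this
      rw [pathDist_comm p r, pathDist_comm q r]
      linarith
  · rw [h]
    exact pathDist_triangle_aux hΓ p q r e f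

/-- The geometric realization of a connected graph as a (pseudo)metric space. -/
@[reducible]
noncomputable def pseudoMetricSpace (hΓ : Γ.Connected) : PseudoMetricSpace (GraphPoint Γ) where
  dist := pathDist
  dist_self p := by simp [pathDist]
  dist_comm := pathDist_comm
  dist_triangle := pathDist_triangle hΓ

end GraphPoint

/-! ### Cayley graphs and word hyperbolic groups -/

/-- A finite symmetric set of generators of the group `G`. -/
structure GeneratingSet (G : Type*) [Group G] where
  carrier : Set G
  finite : carrier.Finite
  inv_mem : ∀ a ∈ carrier, a⁻¹ ∈ carrier
  closure_eq_top : Subgroup.closure carrier = ⊤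

namespace GeneratingSet

variable {G : Type*} [Group G] (A : GeneratingSet G)

/-- The (underlying undirected graph of the) Cayley graph: `g` and `g * a` are joined by an edge
for each generator `a`. -/
def cayleyGraph : SimpleGraph G := SimpleGraph.mulCayley A.carrier

theorem cayleyGraph_connected : A.cayleyGraph.Connected := by
  have step : ∀ (g : G) (a : G), a ∈ A.carrier → A.cayleyGraph.Reachable g (g * a) := by
    intro g a ha
    by_cases h : g = g * a
    · rw [← h]
    · exact SimpleGraph.Adj.reachable
        ((SimpleGraph.mulCayley_adj' _ _ _).2 ⟨h, a, ha, Or.inl rfl⟩)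
  have key : ∀ h : G, ∀ g : G, A.cayleyGraph.Reachable g (g * h) := by
    intro h
    have hh : h ∈ Subgroup.closure A.carrier := by
      rw [A.closure_eq_top]
      trivial
    induction hh using Subgroup.closure_induction with
    | mem a ha => exact fun g => step g a ha
    | one => intro g; rw [mul_one]
    | mul a b _ _ iha ihb =>
      intro g
      rw [← mul_assoc]
      exact (iha g).trans (ihb (g * a))
    | inv a _ iha =>
      intro g
      have := iha (g * a⁻¹)
      rw [inv_mul_cancel_right] at this
      exact this.symm
  have : Nonempty G := ⟨1⟩
  refine SimpleGraph.Connected.mk fun g h => ?_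
  have := key (g⁻¹ * h) g
  rwa [mul_inv_cancel_left] at this

/-- The Cayley graph as a metric space with its path metric. -/
noncomputable instance : PseudoMetricSpace (GraphPoint A.cayleyGraph) :=
  GraphPoint.pseudoMetricSpace A.cayleyGraph_connected

/-- `G`, with the generators `A`, is word hyperbolic: its Cayley graph is a hyperbolic space. -/
def IsWordHyperbolic : Prop := IsHyperbolicSpace (GraphPoint A.cayleyGraph)

/-- Words over `A`. -/
abbrev Word : Type _ := List A.carrier

variable {A}

/-- The element of `G` represented by a word. -/
def Word.image (w : A.Word) : G := (w.map Subtype.val).prod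

/-- The word is a geodesic: its length is the distance in the Cayley graph between the ends of
the path that it labels. -/
def Word.IsGeodesic (w : A.Word) : Prop := w.length = A.cayleyGraph.dist 1 (Word.image w)

/-- The vertices at the times `r, r + 1, …, r + n` of the path from the identity labelled by the
word, that is, its subpath from time `r` to time `r + n` (when `r + n` is at most the length). -/
def Word.subpath (w : A.Word) (r n : ℕ) : Fin (n + 1) → G :=
  fun j => Word.image (A := A) (w.take (r + j))

/-- The input string for a pair of words: the letters are read in parallel, and the shorter word
is padded at its end with the letter `$`, which is `none`. -/
def Word.pad (w w' : A.Word) : List (Option A.carrier × Option A.carrier) :=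
  List.zipWithAll Prod.mk w w'

end GeneratingSet

/-! ### Automatic structures -/

/-- An automatic structure on `G` over the generators `A`: finite automata `W` (the word acceptor)
and `M x` for `x ∈ A ∪ {1}` (the compare automata). -/
structure AutomaticStructure.{u, v} {G : Type u} [Group G] (A : GeneratingSet G) where
  StateW : Type v
  finite_stateW : Finite StateW
  W : DFA A.carrier StateW
  StateM : ↥(insert 1 A.carrier : Set G) → Type v
  finite_stateM : ∀ x, Finite (StateM x)
  M : ∀ x : ↥(insert 1 A.carrier : Set G), DFA (Option A.carrier × Option A.carrier) (StateM x)
  surjective : ∀ g : G, ∃ w ∈ W.accepts, GeneratingSet.Word.image (A := A) w = g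
  mem_M_iff : ∀ (x : ↥(insert 1 A.carrier : Set G)) (w w' : A.Word),
    GeneratingSet.Word.pad w w' ∈ (M x).accepts ↔
      GeneratingSet.Word.image w * (x : G) = GeneratingSet.Word.image w' ∧
        w ∈ W.accepts ∧ w' ∈ W.accepts

namespace AutomaticStructure

variable {G : Type*} [Group G] {A : GeneratingSet G} (S : AutomaticStructure A)

/-- Every prefix of an accepted word is accepted. -/
def IsPrefixClosed : Prop := ∀ w ∈ S.W.accepts, ∀ t ≤ w.length, w.take t ∈ S.W.accepts

/-- Every element of the group is represented by at most one accepted word. -/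
def HasUniqueness : Prop :=
  Set.InjOn (fun w : A.Word => GeneratingSet.Word.image w) {w | w ∈ S.W.accepts}

/-- Every accepted word is a geodesic. -/
def IsWeaklyGeodesic : Prop :=
  ∀ w ∈ S.W.accepts, GeneratingSet.Word.IsGeodesic (A := A) w

/-- `T` consists of `n`-tracks of length `n`: these are `n` mutually disjoint edge paths
`T 0, …, T (n - 1)` of length `n` in the Cayley graph, given by their vertices, for which there are
accepted words `w i`, `w' i` and a time `r > 0` such that `T i` is the subpath of both `w i` and
`w' i` from time `r` to time `r + n`, and `(w' i, w (i + 1))` is accepted by a compare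
automaton. -/
def IsTracks (n : ℕ) (T : Fin n → Fin (n + 1) → G) : Prop :=
  (∀ (i : Fin n) (j : Fin n), (T i j.castSucc)⁻¹ * T i j.succ ∈ A.carrier) ∧
  (∀ i i' : Fin n, i ≠ i' → Disjoint (Set.range (T i)) (Set.range (T i'))) ∧
  ∃ (w w' : Fin n → A.Word) (r : ℕ), 0 < r ∧
    (∀ i, w i ∈ S.W.accepts ∧ w' i ∈ S.W.accepts) ∧
    (∀ (i : ℕ) (hi : i + 1 < n), ∃ x : ↥(insert 1 A.carrier : Set G),
      GeneratingSet.Word.pad (w' ⟨i, Nat.lt_of_succ_lt hi⟩) (w ⟨i + 1, hi⟩) ∈ (S.M x).accepts) ∧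
    ∀ i, r + n ≤ (w i).length ∧ r + n ≤ (w' i).length ∧
      T i = GeneratingSet.Word.subpath (w i) r n ∧ T i = GeneratingSet.Word.subpath (w' i) r n

end AutomaticStructure

/-!
Suppose that there are no `n`-tracks of length `n`; then the Cayley graph is hyperbolic, for the
following reason.

The accepted words form a tree of geodesics from the identity. Join two vertices of the sphere of
radius `t` when the tree geodesics to two adjacent vertices outside the ball of radius `t` pass
through them at time `t` (`levelGraph`). A path of `n` vertices at level `r + n` whose ancestors at
level `r` are distinct would yield `n`-tracks, namely the tree paths between the two levels
(`exists_isTracks_of_injective`). So in every walk at level `r + n`, two of any `n` consecutive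
vertices have the same ancestor, and projection to level `r` shortens lengths by a factor of about
`1 - 1 / n` (`levelDistLE_sub_div`). After `j` projections, a walk of length `N` outside the ball of
radius `t + j * n` becomes one of length about `(1 - 1 / n) ^ j * N` at level `t`, whose steps have
bounded length by the fellow traveller property (`exists_dist_prefixPoint_le`). By homogeneity, the
Cayley graph has superlinear divergence at every vertex (`hasSuperlinearDivergence`).

Superlinear divergence gives the stability of quasi-geodesics (`exists_geodesic_near`,
`exists_near_geodesic`) by the argument of the Morse lemma. It is applied to the quasi-geodesics that
lead from a vertex of a triangle to the nearest point of the opposite side, and on along this side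
(`exists_thin_triangle`). The sides of a triangle in the geometric realization are first replaced by
sequences of vertices.
-/

/-! ### Paths outside balls and quasi-geodesic sequences in graphs -/

section CoarseGeometry

variable {V : Type*} {Γ : SimpleGraph V}

/-- `u` and `v` are joined by a walk of length at most `N` that stays at distance at least `t`
from `o`. -/
def JoinedOutside (Γ : SimpleGraph V) (o : V) (t N : ℕ) (u v : V) : Prop :=
  ∃ p : Γ.Walk u v, p.length ≤ N ∧ ∀ x ∈ p.support, t ≤ Γ.dist o x

theorem JoinedOutside.symm {o u v : V} {t N : ℕ} (h : JoinedOutside Γ o t N u v) :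
    JoinedOutside Γ o t N v u := by
  obtain ⟨p, hp, hs⟩ := h
  exact ⟨p.reverse, by simpa using hp, by simpa using hs⟩

theorem JoinedOutside.trans {o u v w : V} {t N N' : ℕ} (h : JoinedOutside Γ o t N u v)
    (h' : JoinedOutside Γ o t N' v w) : JoinedOutside Γ o t (N + N') u w := by
  obtain ⟨p, hp, hs⟩ := h
  obtain ⟨p', hp', hs'⟩ := h'
  refine ⟨p.append p', ?_, fun x hx => ?_⟩
  · rw [SimpleGraph.Walk.length_append]
    omega
  · rcases (SimpleGraph.Walk.mem_support_append_iff _ _).1 hx with hx | hx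
    exacts [hs x hx, hs' x hx]

theorem JoinedOutside.mono {o u v : V} {t t' N N' : ℕ} (h : JoinedOutside Γ o t N u v)
    (ht : t' ≤ t) (hN : N ≤ N') : JoinedOutside Γ o t' N' u v := by
  obtain ⟨p, hp, hs⟩ := h
  exact ⟨p, hp.trans hN, fun x hx => ht.trans (hs x hx)⟩

theorem joinedOutside_of_dist_le (hΓ : Γ.Connected) {o u v : V} {t m : ℕ}
    (h : Γ.dist u v ≤ m) (ho : t + m ≤ Γ.dist o u) : JoinedOutside Γ o t m u v := by
  classical
  obtain ⟨p, hp⟩ := hΓ.exists_walk_length_eq_dist u v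
  refine ⟨p, by omega, fun x hx => ?_⟩
  have h1 := SimpleGraph.dist_le (p.takeUntil x hx)
  have h2 := p.length_takeUntil_le_length hx
  have h3 := hΓ.dist_triangle (u := o) (v := x) (w := u)
  rw [SimpleGraph.dist_comm (u := x)] at h3
  omega

/-- The vertices `σ 0, …, σ m` are those of a geodesic path. -/
def IsGeodesicSeq (Γ : SimpleGraph V) (σ : ℕ → V) (m : ℕ) : Prop :=
  ∀ i j, i ≤ j → j ≤ m → Γ.dist (σ i) (σ j) = j - i

theorem exists_isGeodesicSeq (hΓ : Γ.Connected) (u v : V) :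
    ∃ σ, IsGeodesicSeq Γ σ (Γ.dist u v) ∧ σ 0 = u ∧ σ (Γ.dist u v) = v := by
  obtain ⟨p, hp⟩ := hΓ.exists_walk_length_eq_dist u v
  have hle : ∀ i j, i ≤ j → j ≤ p.length → Γ.dist (p.getVert i) (p.getVert j) ≤ j - i := by
    intro i j hij
    induction j, hij using Nat.le_induction with
    | base => simp
    | succ j hij ih =>
      intro hj
      have h1 := ih (by omega)
      have h2 := hΓ.dist_triangle (u := p.getVert i) (v := p.getVert j) (w := p.getVert (j + 1))
      have h3 := SimpleGraph.dist_eq_one_iff_adj.2 (p.adj_getVert_succ (i := j) (by omega))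
      omega
  refine ⟨p.getVert, fun i j hij hj => le_antisymm (hle i j hij (by omega)) ?_,
    p.getVert_zero, by rw [← hp, p.getVert_length]⟩
  have h1 := hle 0 i (by omega) (by omega)
  have h2 := hle j p.length (by omega) le_rfl
  rw [p.getVert_zero] at h1
  rw [p.getVert_length] at h2
  have h3 := hΓ.dist_triangle (u := u) (v := p.getVert i) (w := v)
  have h4 := hΓ.dist_triangle (u := p.getVert i) (v := p.getVert j) (w := v)
  omega

/-- The points `c 0, …, c M` form a coarse quasi-geodesic with multiplicative constant `l`. The
steps have length up to `3`, and the additive constant is `3`, which is what the discretization of a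
geodesic of the geometric realization gives. -/
structure IsQuasiGeodesicSeq (Γ : SimpleGraph V) (l : ℕ) (c : ℕ → V) (M : ℕ) : Prop where
  step : ∀ i < M, Γ.dist (c i) (c (i + 1)) ≤ 3
  le_dist : ∀ i j, i ≤ j → j ≤ M → j - i ≤ l * Γ.dist (c i) (c j) + 3

namespace IsQuasiGeodesicSeq

variable {l M : ℕ} {c : ℕ → V}

theorem mono {l' : ℕ} (h : IsQuasiGeodesicSeq Γ l c M) (hl : l ≤ l') :
    IsQuasiGeodesicSeq Γ l' c M :=
  ⟨h.step, fun i j hij hj => (h.le_dist i j hij hj).trans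
    (Nat.add_le_add_right (Nat.mul_le_mul_right _ hl) _)⟩

theorem reverse (h : IsQuasiGeodesicSeq Γ l c M) :
    IsQuasiGeodesicSeq Γ l (fun i => c (M - i)) M := by
  refine ⟨fun i hi => ?_, fun i j hij hj => ?_⟩
  · have := h.step (M - (i + 1)) (by omega)
    rw [show M - (i + 1) + 1 = M - i by omega] at this
    rwa [SimpleGraph.dist_comm]
  · have := h.le_dist (M - j) (M - i) (by omega) (by omega)
    rw [SimpleGraph.dist_comm] at this
    omega

theorem take (h : IsQuasiGeodesicSeq Γ l c M) {K : ℕ} (hK : K ≤ M) :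
    IsQuasiGeodesicSeq Γ l c K :=
  ⟨fun i hi => h.step i (by omega), fun i j hij hj => h.le_dist i j hij (by omega)⟩

theorem drop (h : IsQuasiGeodesicSeq Γ l c M) (K : ℕ) :
    IsQuasiGeodesicSeq Γ l (fun i => c (K + i)) (M - K) := by
  refine ⟨fun i hi => h.step (K + i) (by omega), fun i j hij hj => ?_⟩
  by_cases hK : K ≤ M
  · have := h.le_dist (K + i) (K + j) (by omega) (by omega)
    omega
  · omega

theorem dist_le (h : IsQuasiGeodesicSeq Γ l c M) (hΓ : Γ.Connected) {i j : ℕ} (hij : i ≤ j)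
    (hj : j ≤ M) : Γ.dist (c i) (c j) ≤ 3 * (j - i) := by
  induction j, hij using Nat.le_induction with
  | base => simp
  | succ j hij ih =>
    have h1 := ih (by omega)
    have h2 := hΓ.dist_triangle (u := c i) (v := c j) (w := c (j + 1))
    have h3 := h.step j (by omega)
    omega

theorem joinedOutside (h : IsQuasiGeodesicSeq Γ l c M) (hΓ : Γ.Connected) {o : V} {t : ℕ}
    (ho : ∀ i ≤ M, t + 3 ≤ Γ.dist o (c i)) {i j : ℕ} (hij : i ≤ j) (hj : j ≤ M) :
    JoinedOutside Γ o t (3 * (j - i)) (c i) (c j) := by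
  induction j, hij using Nat.le_induction with
  | base =>
    refine ⟨SimpleGraph.Walk.nil, by simp, fun x hx => ?_⟩
    rw [SimpleGraph.Walk.mem_support_nil_iff] at hx
    have := ho i hj
    rw [hx]
    omega
  | succ j hij ih =>
    exact ((ih (by omega)).trans (joinedOutside_of_dist_le hΓ (h.step j (by omega))
      (ho j (by omega)))).mono le_rfl (by omega)

end IsQuasiGeodesicSeq

/-- Concatenating a geodesic from `z` to its nearest point `c 0` on a coarse geodesic with that
coarse geodesic gives a quasi-geodesic. -/
theorem IsQuasiGeodesicSeq.concat (hΓ : Γ.Connected) {c : ℕ → V} {M : ℕ}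
    (hc : IsQuasiGeodesicSeq Γ 1 c M) {z : V} (hz : ∀ i ≤ M, Γ.dist z (c 0) ≤ Γ.dist z (c i))
    {τ : ℕ → V} {h : ℕ} (hτ : IsGeodesicSeq Γ τ h) (h0 : τ 0 = z) (h1 : τ h = c 0) :
    IsQuasiGeodesicSeq Γ 3 (fun i => if i ≤ h then τ i else c (i - h)) (h + M) := by
  have hzh : Γ.dist z (c 0) = h := by
    have := hτ 0 h (by omega) le_rfl
    rwa [h0, h1] at this
  refine ⟨fun i hi => ?_, fun i j hij hj => ?_⟩
  · rcases lt_trichotomy i h with hih | rfl | hih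
    · have := hτ i (i + 1) (by omega) (by omega)
      simp only [if_pos hih.le, if_pos (show i + 1 ≤ h from hih)]
      omega
    · have := hc.step 0 (by omega)
      simpa [h1] using this
    · have := hc.step (i - h) (by omega)
      rw [show i - h + 1 = i + 1 - h by omega] at this
      simpa only [if_neg (show ¬ i ≤ h by omega), if_neg (show ¬ i + 1 ≤ h by omega)] using this
  · by_cases hjh : j ≤ h
    · have := hτ i j hij hjh
      simp only [if_pos hjh, if_pos (hij.trans hjh)]
      omega
    · by_cases hih : i ≤ h
      · simp only [if_pos hih, if_neg hjh]
        have a1 := hz (j - h) (by omega)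
        have a2 := hΓ.dist_triangle (u := z) (v := τ i) (w := c (j - h))
        have a3 := hτ 0 i (by omega) hih
        have a4 := hτ i h hih le_rfl
        have a5 := hc.le_dist 0 (j - h) (by omega) (by omega)
        have a6 := hΓ.dist_triangle (u := c 0) (v := τ i) (w := c (j - h))
        rw [h0] at a3
        rw [h1, SimpleGraph.dist_comm] at a4
        omega
      · simp only [if_neg hjh, if_neg hih]
        have := hc.le_dist (i - h) (j - h) (by omega) (by omega)
        omega

/-! ### Superlinear divergence and the stability of quasi-geodesics -/

/-- Walks avoiding a ball are superlinearly long: if `u` and `v` are joined by a walk of length `N`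
outside the ball of radius `t + J` around `o`, then their Gromov product based at `o` is at least
`t - (N + C) / (2 * q)`. The slope `q` is arbitrary, and `J` and `C` depend on it alone. -/
def HasSuperlinearDivergence (Γ : SimpleGraph V) : Prop :=
  ∀ q : ℕ, ∃ J C : ℕ, ∀ (o u v : V) (t N : ℕ), JoinedOutside Γ o (t + J) N u v →
    q * (Γ.dist u v + 2 * t) ≤ q * (Γ.dist o u + Γ.dist o v) + N + C

/-- Geodesics stay near quasi-geodesics with the same ends. At a point `o` of the geodesic whose
distance `D` to the quasi-geodesic is largest, the points of the geodesic at distance `2 * D` on both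
sides of `o` (or the ends of the geodesic, if these are nearer) are joined outside the ball of
radius `D - 3` by a walk whose length is linear in `D`, while their Gromov product based at `o` is
`0`. Superlinear divergence therefore bounds `D`. -/
theorem HasSuperlinearDivergence.exists_geodesic_near (hd : HasSuperlinearDivergence Γ)
    (hΓ : Γ.Connected) : ∃ B : ℕ, ∀ (c : ℕ → V) (M : ℕ) (σ : ℕ → V) (m : ℕ),
      IsQuasiGeodesicSeq Γ 3 c M → IsGeodesicSeq Γ σ m → σ 0 = c 0 → σ m = c M →
      ∀ s ≤ m, ∃ i ≤ M, Γ.dist (σ s) (c i) ≤ B := by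
  classical
  -- the walk below has length `D + (54 * D + 9) + D`
  obtain ⟨J, C, hJ⟩ := hd 56
  refine ⟨112 * (3 + J) + 9 + C, fun c M σ m hc hσ h0 hm => ?_⟩
  have hex : ∃ D, ∀ s ≤ m, ∃ i ≤ M, Γ.dist (σ s) (c i) ≤ D := by
    refine ⟨m, fun s hs => ⟨0, by omega, ?_⟩⟩
    have := hσ 0 s (by omega) hs
    rw [← h0, SimpleGraph.dist_comm]
    omega
  obtain ⟨D, hD, hmin⟩ : ∃ D, (∀ s ≤ m, ∃ i ≤ M, Γ.dist (σ s) (c i) ≤ D) ∧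
      ∀ D' < D, ¬ ∀ s ≤ m, ∃ i ≤ M, Γ.dist (σ s) (c i) ≤ D' :=
    ⟨Nat.find hex, Nat.find_spec hex, fun D' h => Nat.find_min hex h⟩
  suffices hDB : D ≤ 112 * (3 + J) + 9 + C by
    intro s hs
    obtain ⟨i, hi, h⟩ := hD s hs
    exact ⟨i, hi, h.trans hDB⟩
  by_contra! hlarge
  have hs0 := hmin (D - 1) (by omega)
  push Not at hs0
  obtain ⟨s0, hs0, hfar⟩ := hs0
  have hfar' : ∀ i ≤ M, D ≤ Γ.dist (σ s0) (c i) := fun i hi => by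
    have := hfar i hi
    omega
  -- an end of the geodesic serves when it is nearer than `2 * D`, as it lies on `c`
  obtain ⟨a, ha, haD, i, hi, hai⟩ : ∃ a ≤ s0, s0 - a ≤ 2 * D ∧ ∃ i ≤ M,
      JoinedOutside Γ (σ s0) D D (σ a) (c i) := by
    by_cases h : 2 * D ≤ s0
    · obtain ⟨i, hi, hi'⟩ := hD (s0 - 2 * D) (by omega)
      refine ⟨s0 - 2 * D, by omega, by omega, i, hi, joinedOutside_of_dist_le hΓ hi' ?_⟩
      have := hσ (s0 - 2 * D) s0 (by omega) hs0
      rw [SimpleGraph.dist_comm]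
      omega
    · refine ⟨0, by omega, by omega, 0, by omega, SimpleGraph.Walk.nil.copy rfl h0, by simp, ?_⟩
      intro x hx
      have := hfar' 0 (by omega)
      simp only [SimpleGraph.Walk.support_copy, SimpleGraph.Walk.mem_support_nil_iff] at hx
      rwa [hx, h0]
  obtain ⟨b, hb, hbm, hbD, j, hj, hbj⟩ : ∃ b, s0 ≤ b ∧ b ≤ m ∧ b - s0 ≤ 2 * D ∧ ∃ j ≤ M,
      JoinedOutside Γ (σ s0) D D (σ b) (c j) := by
    by_cases h : s0 + 2 * D ≤ m
    · obtain ⟨i, hi, hi'⟩ := hD (s0 + 2 * D) h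
      refine ⟨s0 + 2 * D, by omega, by omega, by omega, i, hi, joinedOutside_of_dist_le hΓ hi' ?_⟩
      have := hσ s0 (s0 + 2 * D) (by omega) h
      omega
    · refine ⟨m, hs0, le_rfl, by omega, M, le_rfl, SimpleGraph.Walk.nil.copy rfl hm, by simp, ?_⟩
      intro x hx
      have := hfar' M le_rfl
      simp only [SimpleGraph.Walk.support_copy, SimpleGraph.Walk.mem_support_nil_iff] at hx
      rwa [hx, hm]
  have dij : Γ.dist (c i) (c j) ≤ 6 * D := by
    obtain ⟨p, hp, -⟩ := hai
    obtain ⟨p', hp', -⟩ := hbj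
    have e1 := SimpleGraph.dist_le p
    have e2 := SimpleGraph.dist_le p'
    have e3 := hσ a b (by omega) hbm
    have e4 := hΓ.dist_triangle (u := c i) (v := σ a) (w := c j)
    have e5 := hΓ.dist_triangle (u := σ a) (v := σ b) (w := c j)
    rw [SimpleGraph.dist_comm (u := c i) (v := σ a)] at e4
    omega
  have hcij : JoinedOutside Γ (σ s0) (D - 3) (54 * D + 9) (c i) (c j) := by
    have ho : ∀ i ≤ M, D - 3 + 3 ≤ Γ.dist (σ s0) (c i) := fun i hi => by
      have := hfar' i hi
      omega
    rcases le_total i j with hij | hij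
    · have := hc.le_dist i j hij hj
      exact (hc.joinedOutside hΓ ho hij hj).mono le_rfl (by omega)
    · have := hc.le_dist j i hij hi
      rw [SimpleGraph.dist_comm] at this
      exact (hc.joinedOutside hΓ ho hij hi).symm.mono le_rfl (by omega)
  have hab := ((hai.mono (t' := D - 3) (by omega) le_rfl).trans hcij).trans
    (hbj.symm.mono (t' := D - 3) (by omega) le_rfl)
  have key := hJ (σ s0) (σ a) (σ b) (D - 3 - J) _
    (hab.mono (t' := D - 3 - J + J) (by omega) le_rfl)
  have e1 := hσ a b (by omega) hbm
  have e2 := hσ a s0 ha hs0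
  have e3 := hσ s0 b hb hbm
  rw [SimpleGraph.dist_comm] at e2
  omega

/-- A point of the quasi-geodesic is close to the geodesic, since the geodesic passes from points near
the earlier part of the quasi-geodesic to points near its later part. -/
theorem HasSuperlinearDivergence.exists_near_geodesic (hd : HasSuperlinearDivergence Γ)
    (hΓ : Γ.Connected) : ∃ B : ℕ, ∀ (c : ℕ → V) (M : ℕ) (σ : ℕ → V) (m : ℕ),
      IsQuasiGeodesicSeq Γ 3 c M → IsGeodesicSeq Γ σ m → σ 0 = c 0 → σ m = c M →
      ∀ i ≤ M, ∃ s ≤ m, Γ.dist (c i) (σ s) ≤ B := by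
  obtain ⟨B, hB⟩ := hd.exists_geodesic_near hΓ
  refine ⟨3 * (3 * (2 * B + 1) + 3) + B, fun c M σ m hc hσ h0 hm k hk => ?_⟩
  have hex : ∃ s, s ≤ m ∧ ∃ j, k ≤ j ∧ j ≤ M ∧ Γ.dist (σ s) (c j) ≤ B :=
    ⟨m, le_rfl, M, hk, le_rfl, by simp [hm]⟩
  classical
  obtain ⟨hs, j, hkj, hj, hjB⟩ := Nat.find_spec hex
  have hmin := fun s (h : s < Nat.find hex) => Nat.find_min hex h
  generalize Nat.find hex = s at hs hjB hmin
  obtain ⟨i, hik, hiB⟩ : ∃ i ≤ k, Γ.dist (σ s) (c i) ≤ B + 1 := by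
    rcases Nat.eq_zero_or_pos s with rfl | hpos
    · exact ⟨0, by omega, by simp [h0]⟩
    · obtain ⟨i, hi, hiB⟩ := hB c M σ m hc hσ h0 hm (s - 1) (by omega)
      refine ⟨i, ?_, ?_⟩
      · by_contra! h
        exact hmin (s - 1) (by omega) ⟨by omega, i, h.le, hi, hiB⟩
      · have h1 := hσ (s - 1) s (by omega) hs
        have h2 := hΓ.dist_triangle (u := σ s) (v := σ (s - 1)) (w := c i)
        rw [SimpleGraph.dist_comm] at h1
        omega
  refine ⟨s, hs, ?_⟩
  have e1 := hΓ.dist_triangle (u := c i) (v := σ s) (w := c j)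
  have e2 := hc.le_dist i j (by omega) hj
  have e3 := hc.dist_le hΓ hkj hj
  have e4 := hΓ.dist_triangle (u := c k) (v := c j) (w := σ s)
  rw [SimpleGraph.dist_comm (u := c i) (v := σ s)] at e1
  rw [SimpleGraph.dist_comm (u := c j) (v := σ s)] at e4
  omega

/-- Quasi-geodesics with the same ends are close to each other. -/
theorem HasSuperlinearDivergence.exists_near_quasiGeodesic (hd : HasSuperlinearDivergence Γ)
    (hΓ : Γ.Connected) : ∃ B : ℕ, ∀ (c : ℕ → V) (M : ℕ) (c' : ℕ → V) (M' : ℕ),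
      IsQuasiGeodesicSeq Γ 3 c M → IsQuasiGeodesicSeq Γ 3 c' M' → c 0 = c' 0 → c M = c' M' →
      ∀ i ≤ M, ∃ j ≤ M', Γ.dist (c i) (c' j) ≤ B := by
  obtain ⟨B, hB⟩ := hd.exists_near_geodesic hΓ
  obtain ⟨B', hB'⟩ := hd.exists_geodesic_near hΓ
  refine ⟨B + B', fun c M c' M' hc hc' h0 hM i hi => ?_⟩
  obtain ⟨σ, hσ, hσ0, hσm⟩ := exists_isGeodesicSeq hΓ (c 0) (c M)
  obtain ⟨s, hs, hsB⟩ := hB c M σ _ hc hσ hσ0 hσm i hi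
  obtain ⟨j, hj, hjB⟩ := hB' c' M' σ _ hc' hσ (hσ0.trans h0) (hσm.trans hM) s hs
  exact ⟨j, hj, hΓ.dist_triangle.trans (Nat.add_le_add hsB hjB)⟩

/-- In a triangle of coarse geodesics, each side is close to the union of the other two: the
side splits at its point nearest to the opposite vertex, and each half, preceded by a geodesic from
that vertex, is a quasi-geodesic. -/
theorem HasSuperlinearDivergence.exists_thin_triangle (hd : HasSuperlinearDivergence Γ)
    (hΓ : Γ.Connected) : ∃ B : ℕ, ∀ (a b c : ℕ → V) (K L M : ℕ),
      IsQuasiGeodesicSeq Γ 1 a K → IsQuasiGeodesicSeq Γ 1 b L → IsQuasiGeodesicSeq Γ 1 c M →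
      a K = b 0 → b L = c 0 → c M = a 0 →
      ∀ i ≤ K, (∃ j ≤ L, Γ.dist (a i) (b j) ≤ B) ∨ ∃ j ≤ M, Γ.dist (a i) (c j) ≤ B := by
  obtain ⟨B, hB⟩ := hd.exists_near_quasiGeodesic hΓ
  have half : ∀ (a b : ℕ → V) (K L : ℕ), IsQuasiGeodesicSeq Γ 1 a K → IsQuasiGeodesicSeq Γ 1 b L →
      (∀ i ≤ K, Γ.dist (b 0) (a 0) ≤ Γ.dist (b 0) (a i)) → a K = b L →
      ∀ i ≤ K, ∃ j ≤ L, Γ.dist (a i) (b j) ≤ B := by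
    intro a b K L ha hb hnear hab i hi
    obtain ⟨τ, hτ, h0, h1⟩ := exists_isGeodesicSeq hΓ (b 0) (a 0)
    have hq := ha.concat hΓ hnear hτ h0 h1
    generalize Γ.dist (b 0) (a 0) = h at hτ h1 hq
    have hval : ∀ i, (if h + i ≤ h then τ (h + i) else a (h + i - h)) = a i := by
      intro i
      rcases Nat.eq_zero_or_pos i with rfl | hpos
      · simpa using h1
      · rw [if_neg (by omega), Nat.add_sub_cancel_left]
    have := hB _ _ b L hq (hb.mono (by omega)) (by simpa using h0)
      (by simpa only [hval] using hab) (h + i) (by omega)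
    simpa only [hval] using this
  refine ⟨B, fun a b c K L M ha hb hc hab hbc hca i hi => ?_⟩
  obtain ⟨k, hk, hmin⟩ := Finset.exists_min_image (Finset.range (K + 1))
    (fun i => Γ.dist (c 0) (a i)) ⟨0, by simp⟩
  have hk : k ≤ K := by simpa [Nat.lt_succ_iff] using hk
  have hmin : ∀ j ≤ K, Γ.dist (c 0) (a k) ≤ Γ.dist (c 0) (a j) :=
    fun j hj => hmin j (by simpa [Nat.lt_succ_iff] using hj)
  rcases le_total k i with hki | hik
  · left
    obtain ⟨j, hj, h⟩ := half (fun i => a (k + i)) (fun j => b (L - j)) (K - k) L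
      (ha.drop k) hb.reverse
      (fun i hi => by simpa [hbc] using hmin (k + i) (by omega))
      (by simp only [Nat.sub_self]; rw [show k + (K - k) = K by omega, hab]) (i - k) (by omega)
    refine ⟨L - j, by omega, ?_⟩
    rwa [show k + (i - k) = i by omega] at h
  · right
    obtain ⟨j, hj, h⟩ := half (fun i => a (k - i)) c k M (ha.take hk).reverse hc
      (fun i hi => by simpa using hmin (k - i) (by omega)) (by simp [hca]) (k - i) (by omega)
    refine ⟨j, hj, ?_⟩
    rwa [show k - (k - i) = i by omega] at h

end CoarseGeometry

/-! ### Geodesic triangles in the geometric realization -/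

namespace GraphPoint

variable {V : Type*} {Γ : SimpleGraph V}

theorem pathDist_le_dist_src_add_two (p q : GraphPoint Γ) :
    pathDist p q ≤ Γ.dist p.src q.src + 2 := by
  have h := pathDist_le_via p q false false
  have h1 := p.t_le_one
  have h2 := q.t_le_one
  simp only [via, vert, offset, Bool.false_eq_true, if_false] at h
  linarith

theorem dist_src_le_pathDist_add_two (hΓ : Γ.Connected) (p q : GraphPoint Γ) :
    (Γ.dist p.src q.src : ℝ) ≤ pathDist p q + 2 := by
  rcases pathDist_cases p q with ⟨m, hm, h⟩ | ⟨e, f, h⟩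
  · have h1 : Γ.dist p.src q.src ≤ 1 := by
      rcases hm with ⟨hs, -, -⟩ | ⟨ha, -, ht, -⟩
      · simp [hs]
      · rw [← ht, SimpleGraph.dist_eq_one_iff_adj.2 ha]
    have h2 : (Γ.dist p.src q.src : ℝ) ≤ 1 := by exact_mod_cast h1
    have := abs_nonneg (p.t - m)
    linarith
  · have h1 := dist_vert_le p false e
    have h2 := dist_vert_le q f false
    have h3 : (Γ.dist p.src q.src : ℝ) ≤ Γ.dist (p.vert false) (p.vert e) +
        Γ.dist (p.vert e) (q.vert f) + Γ.dist (q.vert f) (q.vert false) := by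
      exact_mod_cast (hΓ.dist_triangle (v := q.vert f)).trans
        (Nat.add_le_add_right (hΓ.dist_triangle (v := p.vert e)) _)
    have h4 := p.t_le_one
    have h5 := q.t_le_one
    rw [h]
    unfold via
    simp only [show p.offset false = p.t from rfl, show q.offset false = q.t from rfl] at h1 h2
    linarith

end GraphPoint

section Realization

variable {V : Type*} {Γ : SimpleGraph V}

/-- Vertices near the points at integral times of a geodesic segment, followed by one near its end,
form a coarse geodesic. -/
theorem exists_isQuasiGeodesicSeq_of_isGeodesicSegment (hΓ : Γ.Connected) {x y : GraphPoint Γ}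
    {a : Set (GraphPoint Γ)}
    (ha : @IsGeodesicSegment _ (GraphPoint.pseudoMetricSpace hΓ) x y a) :
    ∃ (c : ℕ → V) (M : ℕ), IsQuasiGeodesicSeq Γ 1 c M ∧ c 0 = x.src ∧ c M = y.src ∧
      (∀ u ∈ a, ∃ i ≤ M, Γ.dist u.src (c i) ≤ 3) ∧ ∀ i ≤ M, ∃ u ∈ a, u.src = c i := by
  let := GraphPoint.pseudoMetricSpace hΓ
  have up : ∀ p q : GraphPoint Γ, (Γ.dist p.src q.src : ℝ) ≤ dist p q + 2 :=
    GraphPoint.dist_src_le_pathDist_add_two hΓ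
  have low : ∀ p q : GraphPoint Γ, dist p q ≤ Γ.dist p.src q.src + 2 :=
    GraphPoint.pathDist_le_dist_src_add_two
  obtain ⟨γ, h0, h1, hγ, rfl⟩ := ha
  have hℓ : 0 ≤ dist x y := dist_nonneg
  generalize dist x y = ℓ at *
  have mem : ∀ i : ℕ, min (i : ℝ) ℓ ∈ Set.Icc 0 ℓ :=
    fun i => ⟨le_min (Nat.cast_nonneg i) hℓ, min_le_right _ _⟩
  have hM : ℓ ≤ (⌈ℓ⌉₊ : ℝ) := Nat.le_ceil ℓ
  refine ⟨fun i => (γ (min (i : ℝ) ℓ)).src, ⌈ℓ⌉₊, ⟨fun i hi => ?_, fun i j hij hj => ?_⟩, ?_, ?_,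
    ?_, ?_⟩
  · have h2 := up (γ (min (i : ℝ) ℓ)) (γ (min ((i + 1 : ℕ) : ℝ) ℓ))
    rw [hγ _ (mem _) _ (mem _), abs_sub_comm] at h2
    have h3 : |min ((i + 1 : ℕ) : ℝ) ℓ - min (i : ℝ) ℓ| ≤ 1 := by
      refine (abs_min_sub_min_le_max _ _ _ _).trans ?_
      simp
    have h4 : (Γ.dist (γ (min (i : ℝ) ℓ)).src (γ (min ((i + 1 : ℕ) : ℝ) ℓ)).src : ℝ) ≤ (3 : ℕ) := by
      push_cast at h2 h3 ⊢
      linarith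
    exact_mod_cast h4
  · have h2 := low (γ (min (i : ℝ) ℓ)) (γ (min (j : ℝ) ℓ))
    rw [hγ _ (mem _) _ (mem _)] at h2
    have h3 : (j : ℝ) - 1 ≤ min (j : ℝ) ℓ := by
      refine le_min (by linarith) ?_
      have h4 : (j : ℝ) ≤ (⌈ℓ⌉₊ : ℝ) := by exact_mod_cast hj
      have h5 := Nat.ceil_lt_add_one hℓ
      linarith
    have h6 := min_le_left (i : ℝ) ℓ
    have h7 := neg_abs_le (min (i : ℝ) ℓ - min (j : ℝ) ℓ)
    have h8 : (j : ℝ) ≤ i + (Γ.dist (γ (min (i : ℝ) ℓ)).src (γ (min (j : ℝ) ℓ)).src + 3) := by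
      linarith
    have h9 : j ≤ i + (Γ.dist (γ (min (i : ℝ) ℓ)).src (γ (min (j : ℝ) ℓ)).src + 3) := by
      exact_mod_cast h8
    omega
  · simp [hℓ, h0]
  · simp [hM, h1]
  · rintro u ⟨s, hs, rfl⟩
    have hfl := Nat.floor_le hs.1
    have hfl' := Nat.lt_floor_add_one s
    refine ⟨⌊s⌋₊, (Nat.floor_le_ceil s).trans (Nat.ceil_mono hs.2), ?_⟩
    have h2 := up (γ s) (γ (min (⌊s⌋₊ : ℝ) ℓ))
    rw [hγ _ hs _ (mem _), min_eq_left (hfl.trans hs.2), abs_of_nonneg (by linarith)] at h2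
    simp only [min_eq_left (hfl.trans hs.2)]
    have h4 : (Γ.dist (γ s).src (γ (⌊s⌋₊ : ℝ)).src : ℝ) ≤ (3 : ℕ) := by
      push_cast
      linarith
    exact_mod_cast h4
  · exact fun i _ => ⟨_, ⟨_, mem i, rfl⟩, rfl⟩

/-- The geometric realization inherits thin triangles from the vertex set, up to rounding. -/
theorem HasSuperlinearDivergence.isHyperbolicSpace (hd : HasSuperlinearDivergence Γ)
    (hΓ : Γ.Connected) :
    @IsHyperbolicSpace (GraphPoint Γ) (GraphPoint.pseudoMetricSpace hΓ) := by
  let := GraphPoint.pseudoMetricSpace hΓ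
  obtain ⟨B, hB⟩ := hd.exists_thin_triangle hΓ
  refine ⟨B + 5, by positivity, fun x y z a b c ha hb hc u hu => ?_⟩
  obtain ⟨a', K, qa, a0, aK, a1, -⟩ := exists_isQuasiGeodesicSeq_of_isGeodesicSegment hΓ ha
  obtain ⟨b', L, qb, b0, bL, -, b2⟩ := exists_isQuasiGeodesicSeq_of_isGeodesicSegment hΓ hb
  obtain ⟨c', M, qc, c0, cM, -, c2⟩ := exists_isQuasiGeodesicSeq_of_isGeodesicSegment hΓ hc
  obtain ⟨i, hi, hui⟩ := a1 u hu
  have close : ∀ v : GraphPoint Γ, Γ.dist (a' i) v.src ≤ B → dist u v ≤ B + 5 := by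
    intro v hv
    have h1 : dist u v ≤ Γ.dist u.src v.src + 2 := GraphPoint.pathDist_le_dist_src_add_two u v
    have h2 : Γ.dist u.src v.src ≤ 3 + B := hΓ.dist_triangle.trans (Nat.add_le_add hui hv)
    have h3 : (Γ.dist u.src v.src : ℝ) ≤ 3 + B := by exact_mod_cast h2
    linarith
  rcases hB a' b' c' K L M qa qb qc (aK.trans b0.symm) (bL.trans c0.symm) (cM.trans a0.symm) i hi
    with ⟨j, hj, h⟩ | ⟨j, hj, h⟩
  · obtain ⟨v, hv, hvj⟩ := b2 j hj
    exact ⟨v, Or.inl hv, close v (by rwa [hvj])⟩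
  · obtain ⟨v, hv, hvj⟩ := c2 j hj
    exact ⟨v, Or.inr hv, close v (by rwa [hvj])⟩

end Realization

/-! ### Words and the geometry of the Cayley graph -/

namespace GeneratingSet

variable {G : Type*} [Group G] (A : GeneratingSet G)

theorem cayleyGraph_adj {g h : G} : A.cayleyGraph.Adj g h ↔ g ≠ h ∧ g⁻¹ * h ∈ A.carrier := by
  refine (SimpleGraph.mulCayley_adj' _ _ _).trans (and_congr_right fun _ => ?_)
  constructor
  · rintro ⟨a, ha, rfl | rfl⟩
    · simpa using ha
    · simpa using A.inv_mem a ha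
  · exact fun h => ⟨_, h, Or.inl (mul_inv_cancel_left _ _)⟩

/-- Left multiplication is an automorphism of the Cayley graph. -/
def mulLeftHom (x : G) : A.cayleyGraph →g A.cayleyGraph where
  toFun g := x * g
  map_rel' {g h} hgh := by
    rw [cayleyGraph_adj] at hgh ⊢
    exact ⟨fun h => hgh.1 (mul_left_cancel h), by simpa [mul_assoc] using hgh.2⟩

theorem dist_mul_left (x g h : G) : A.cayleyGraph.dist (x * g) (x * h) = A.cayleyGraph.dist g h := by
  have hle : ∀ x g h : G, A.cayleyGraph.dist (x * g) (x * h) ≤ A.cayleyGraph.dist g h := by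
    intro x g h
    obtain ⟨p, hp⟩ := A.cayleyGraph_connected.exists_walk_length_eq_dist g h
    rw [← hp, ← p.length_map (A.mulLeftHom x)]
    exact SimpleGraph.dist_le _
  refine le_antisymm (hle x g h) ?_
  simpa using hle x⁻¹ (x * g) (x * h)

theorem dist_mul_right_le_one {a : G} (ha : a ∈ insert 1 A.carrier) (g : G) :
    A.cayleyGraph.dist g (g * a) ≤ 1 := by
  by_cases h : g = g * a
  · rw [← h]
    simp
  · refine (SimpleGraph.dist_eq_one_iff_adj.2 (A.cayleyGraph_adj.2 ⟨h, ?_⟩)).le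
    rcases ha with rfl | ha
    · simp at h
    · simpa using ha

variable {A}

theorem Word.image_append (w w' : A.Word) :
    Word.image (A := A) (w ++ w') = Word.image (A := A) w * Word.image (A := A) w' := by
  simp [Word.image]

theorem Word.dist_mul_image_le (g : G) (w : A.Word) :
    A.cayleyGraph.dist g (g * Word.image (A := A) w) ≤ w.length := by
  induction w generalizing g with
  | nil => simp [Word.image]
  | cons a w ih =>
    have h1 := A.dist_mul_right_le_one (Or.inr a.2) g
    have h2 := ih (g * a)
    have h3 := A.cayleyGraph_connected.dist_triangle (u := g) (v := g * a)
      (w := g * a * Word.image (A := A) w)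
    have h4 : Word.image (A := A) (a :: w) = a * Word.image (A := A) w := by simp [Word.image]
    rw [h4, ← mul_assoc, List.length_cons]
    omega

theorem Word.pad_append {u v : A.Word} (h : u.length = v.length) (u' v' : A.Word) :
    Word.pad (u ++ u') (v ++ v') = Word.pad u v ++ Word.pad u' v' := by
  induction u generalizing v with
  | nil =>
    obtain rfl : v = [] := List.length_eq_zero_iff.1 h.symm
    rfl
  | cons a u ih =>
    cases v with
    | nil => simp at h
    | cons b v =>
      have := ih (v := v) (by simpa using h)
      simp only [Word.pad] at this
      simp [Word.pad, this]

end GeneratingSet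

open GeneratingSet

namespace AutomaticStructure

variable {G : Type*} [Group G] {A : GeneratingSet G} (S : AutomaticStructure A)

/-- An accepted word representing `g`; it is the only one if `S` has the uniqueness property. -/
noncomputable def word (g : G) : A.Word := (S.surjective g).choose

/-- The vertex at time `t` of the path labelled by the accepted word of `g`, or `g` itself if the
word is shorter than `t`. -/
noncomputable def prefixPoint (t : ℕ) (g : G) : G := Word.image (A := A) ((S.word g).take t)

theorem word_mem (g : G) : S.word g ∈ S.W.accepts := (S.surjective g).choose_spec.1

@[simp]
theorem image_word (g : G) : Word.image (A := A) (S.word g) = g := (S.surjective g).choose_spec.2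

variable {S}

theorem word_image (hu : S.HasUniqueness) {w : A.Word} (hw : w ∈ S.W.accepts) :
    S.word (Word.image (A := A) w) = w :=
  hu (S.word_mem _) hw (S.image_word _)

theorem length_word (hg : S.IsWeaklyGeodesic) (g : G) :
    (S.word g).length = A.cayleyGraph.dist 1 g := by
  have := hg _ (S.word_mem g)
  rwa [Word.IsGeodesic, image_word] at this

theorem word_prefixPoint (hp : S.IsPrefixClosed) (hu : S.HasUniqueness) (t : ℕ) (g : G) :
    S.word (S.prefixPoint t g) = (S.word g).take t := by
  refine word_image hu ?_
  rcases le_total t (S.word g).length with h | h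
  · exact hp _ (S.word_mem g) t h
  · rw [List.take_of_length_le h]
    exact S.word_mem g

theorem prefixPoint_prefixPoint (hp : S.IsPrefixClosed) (hu : S.HasUniqueness) {s t : ℕ}
    (hst : s ≤ t) (g : G) : S.prefixPoint s (S.prefixPoint t g) = S.prefixPoint s g := by
  rw [prefixPoint, word_prefixPoint hp hu, List.take_take, min_eq_left hst, prefixPoint]

theorem dist_prefixPoint_le (hg : S.IsWeaklyGeodesic) (t : ℕ) (g : G) :
    A.cayleyGraph.dist (S.prefixPoint t g) g ≤ A.cayleyGraph.dist 1 g - t := by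
  have h1 := Word.dist_mul_image_le (A := A) (S.prefixPoint t g) ((S.word g).drop t)
  rw [prefixPoint, ← Word.image_append, List.take_append_drop, image_word, List.length_drop,
    length_word hg] at h1
  exact h1

/-- The fellow traveller property. Whenever a compare automaton can still reach an accepting state
from a given state, some fixed pair of words leads there; as there are finitely many states,
these pairs bound the distance between the two prefixes read so far. -/
theorem exists_dist_prefixPoint_le : ∃ k : ℕ, ∀ (g h : G) (t : ℕ), A.cayleyGraph.Adj g h →
    t ≤ (S.word g).length → t ≤ (S.word h).length →
      A.cayleyGraph.dist (S.prefixPoint t g) (S.prefixPoint t h) ≤ k := by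
  have hF : ∀ y : Σ x, S.StateM x, ∃ k : ℕ,
      (∃ c c' : A.Word, (S.M y.1).evalFrom y.2 (Word.pad c c') ∈ (S.M y.1).accept) →
      ∃ c c' : A.Word, (S.M y.1).evalFrom y.2 (Word.pad c c') ∈ (S.M y.1).accept ∧
        c.length + c'.length + 1 ≤ k := by
    intro y
    by_cases h : ∃ c c' : A.Word, (S.M y.1).evalFrom y.2 (Word.pad c c') ∈ (S.M y.1).accept
    · obtain ⟨c, c', hc⟩ := h
      exact ⟨_, fun _ => ⟨c, c', hc, le_rfl⟩⟩
    · exact ⟨0, fun h' => absurd h' h⟩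
  choose F hF using hF
  have : Finite ↥(insert 1 A.carrier : Set G) := (A.finite.insert 1).to_subtype
  have := S.finite_stateM
  obtain ⟨k, hk⟩ := (Set.finite_range F).bddAbove
  refine ⟨k, fun g h t hgh htg hth => ?_⟩
  let x : ↥(insert 1 A.carrier : Set G) := ⟨g⁻¹ * h, Or.inr (A.cayleyGraph_adj.1 hgh).2⟩
  have hlen : ((S.word g).take t).length = ((S.word h).take t).length := by
    simp [htg, hth]
  have hacc : Word.pad (S.word g) (S.word h) ∈ (S.M x).accepts :=
    (S.mem_M_iff x _ _).2 ⟨by simp [x], S.word_mem g, S.word_mem h⟩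
  rw [← List.take_append_drop t (S.word g), ← List.take_append_drop t (S.word h),
    Word.pad_append hlen, DFA.mem_accepts, DFA.eval, DFA.evalFrom_of_append] at hacc
  obtain ⟨c, c', hc, hle⟩ := hF ⟨x, (S.M x).evalFrom (S.M x).start
    (Word.pad ((S.word g).take t) ((S.word h).take t))⟩ ⟨_, _, hacc⟩
  have hle' := hle.trans (hk ⟨_, rfl⟩)
  simp only [← DFA.evalFrom_of_append, ← Word.pad_append hlen] at hc
  have heq := ((S.mem_M_iff x _ _).1 hc).1
  rw [Word.image_append, Word.image_append] at heq
  have d1 := Word.dist_mul_image_le (A := A) (S.prefixPoint t g) c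
  have d2 := A.dist_mul_right_le_one x.2 (S.prefixPoint t g * Word.image (A := A) c)
  have d3 := Word.dist_mul_image_le (A := A) (S.prefixPoint t h) c'
  rw [prefixPoint, heq, ← prefixPoint] at d2
  rw [SimpleGraph.dist_comm] at d3
  have hΓ := A.cayleyGraph_connected
  have d4 := hΓ.dist_triangle (u := S.prefixPoint t g)
    (v := S.prefixPoint t g * Word.image (A := A) c) (w := S.prefixPoint t h)
  have d5 := hΓ.dist_triangle (u := S.prefixPoint t g * Word.image (A := A) c)
    (v := S.prefixPoint t h * Word.image (A := A) c') (w := S.prefixPoint t h)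
  unfold prefixPoint at *
  omega

/-! ### Level graphs and their contraction in the absence of tracks -/

variable (S)

/-- The level graph at time `t`: distinct vertices of the sphere of radius `t` are joined if they
are the points at time `t` of the accepted words of two neighbours in the Cayley graph. -/
def levelGraph (t : ℕ) : SimpleGraph G where
  Adj x y := x ≠ y ∧ ∃ g h, A.cayleyGraph.Adj g h ∧ t ≤ (S.word g).length ∧
    t ≤ (S.word h).length ∧ S.prefixPoint t g = x ∧ S.prefixPoint t h = y
  symm := ⟨fun _ _ ⟨hne, g, h, ha, hg, hh, hx, hy⟩ => ⟨hne.symm, h, g, ha.symm, hh, hg, hy, hx⟩⟩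
  loopless := ⟨fun _ h => h.1 rfl⟩

/-- `x` and `y` are at distance at most `N` in the level graph at time `t`. -/
def LevelDistLE (t N : ℕ) (x y : G) : Prop := ∃ p : (S.levelGraph t).Walk x y, p.length ≤ N

variable {S}

theorem LevelDistLE.refl (t N : ℕ) (x : G) : S.LevelDistLE t N x x :=
  ⟨SimpleGraph.Walk.nil, Nat.zero_le _⟩

theorem LevelDistLE.trans {t N N' : ℕ} {x y z : G} (h : S.LevelDistLE t N x y)
    (h' : S.LevelDistLE t N' y z) : S.LevelDistLE t (N + N') x z := by
  obtain ⟨p, hp⟩ := h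
  obtain ⟨p', hp'⟩ := h'
  exact ⟨p.append p', by rw [SimpleGraph.Walk.length_append]; omega⟩

theorem LevelDistLE.mono {t N N' : ℕ} {x y : G} (h : S.LevelDistLE t N x y) (hN : N ≤ N') :
    S.LevelDistLE t N' x y := by
  obtain ⟨p, hp⟩ := h
  exact ⟨p, hp.trans hN⟩

theorem levelDistLE_one_of_adj {t : ℕ} {g h : G} (hgh : A.cayleyGraph.Adj g h)
    (hg : t ≤ (S.word g).length) (hh : t ≤ (S.word h).length) :
    S.LevelDistLE t 1 (S.prefixPoint t g) (S.prefixPoint t h) := by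
  by_cases heq : S.prefixPoint t g = S.prefixPoint t h
  · rw [heq]
    exact LevelDistLE.refl _ _ _
  · have : (S.levelGraph t).Adj (S.prefixPoint t g) (S.prefixPoint t h) :=
      ⟨heq, g, h, hgh, hg, hh, rfl, rfl⟩
    exact ⟨this.toWalk, by simp⟩

theorem levelDistLE_of_adj_seq (hp : S.IsPrefixClosed) (hu : S.HasUniqueness) {r t : ℕ}
    (hrt : r ≤ t) {c : ℕ → G} {i j : ℕ} (hij : i ≤ j)
    (hc : ∀ k, i ≤ k → k < j → (S.levelGraph t).Adj (c k) (c (k + 1))) :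
    S.LevelDistLE r (j - i) (S.prefixPoint r (c i)) (S.prefixPoint r (c j)) := by
  induction j, hij using Nat.le_induction with
  | base => exact LevelDistLE.refl _ _ _
  | succ j hij ih =>
    obtain ⟨-, g, h, hgh, hg, hh, hx, hy⟩ := hc j hij (by omega)
    have h1 := levelDistLE_one_of_adj hgh (hrt.trans hg) (hrt.trans hh)
    rw [← prefixPoint_prefixPoint hp hu hrt g, ← prefixPoint_prefixPoint hp hu hrt h, hx, hy] at h1
    exact ((ih fun k hk hk' => hc k hk (by omega)).trans h1).mono (by omega)

/-- If a walk of length `n` in the level graph at time `r + n` has its first `n` vertices over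
distinct vertices at time `r`, then the paths from time `r` to time `r + n` leading to
these `n` vertices are tracks. -/
theorem exists_isTracks_of_injective (hp : S.IsPrefixClosed) (hu : S.HasUniqueness)
    {n r : ℕ} (hr : 0 < r) {c : ℕ → G}
    (hc : ∀ k < n, (S.levelGraph (r + n)).Adj (c k) (c (k + 1)))
    (hinj : ∀ i j, i < j → j < n → S.prefixPoint r (c i) ≠ S.prefixPoint r (c j)) :
    ∃ T : Fin n → Fin (n + 1) → G, S.IsTracks n T := by
  choose! hne g h hgh hgl hhl hgc hhc using hc
  -- `w i` comes from the edge entering `c i`; the first vertex has none and reuses the next edge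
  let w : ℕ → G := fun i => if i = 0 then g 0 else h (i - 1)
  have hw : ∀ i < n, r + n ≤ (S.word (w i)).length ∧ S.prefixPoint (r + n) (w i) = c i := by
    intro i hi
    rcases Nat.eq_zero_or_pos i with rfl | hpos
    · exact ⟨hgl 0 hi, hgc 0 hi⟩
    · have h1 := hhl (i - 1) (by omega)
      have h2 := hhc (i - 1) (by omega)
      rw [show i - 1 + 1 = i by omega] at h2
      simpa [w, hpos.ne'] using ⟨h1, h2⟩
  have hwc : ∀ i < n, (S.word (c i)).length = r + n := by
    intro i hi
    rw [← (hw i hi).2, word_prefixPoint hp hu]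
    simpa using (hw i hi).1
  have hsub : ∀ v x : G, S.prefixPoint (r + n) v = x →
      Word.subpath (S.word x) r n = Word.subpath (S.word v) r n := by
    rintro v x rfl
    funext j
    have := j.2
    rw [Word.subpath, Word.subpath, word_prefixPoint hp hu, List.take_take,
      min_eq_left (by omega)]
  refine ⟨fun i => Word.subpath (S.word (c i)) r n, ?_, ?_, fun i => S.word (w i),
    fun i => S.word (g i), r, hr, fun i => ⟨S.word_mem _, S.word_mem _⟩, ?_, ?_⟩
  · intro i j
    have hlt : r + (j : ℕ) < (S.word (c i)).length := by
      rw [hwc i i.2]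
      omega
    simp only [Word.subpath, Fin.val_castSucc, Fin.val_succ, ← add_assoc]
    rw [List.take_succ_eq_append_getElem hlt, Word.image_append, inv_mul_cancel_left]
    simp [Word.image]
  · have hmain : ∀ i i' : Fin n, i < i' → Disjoint (Set.range (Word.subpath (S.word (c i)) r n))
        (Set.range (Word.subpath (S.word (c i')) r n)) := by
      intro i i' hii'
      rw [Set.disjoint_left]
      rintro _ ⟨j, rfl⟩ ⟨j', hjj'⟩
      change S.prefixPoint (r + j') (c i') = S.prefixPoint (r + j) (c i) at hjj'
      -- points at different times have different distances from the identity
      have hlen := congrArg (fun x => (S.word x).length) hjj'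
      have h1 := j.2
      have h2 := j'.2
      simp only [word_prefixPoint hp hu, List.length_take, hwc i i.2, hwc i' i'.2] at hlen
      have hj : (j' : ℕ) = j := by omega
      refine hinj i i' hii' i'.2 ?_
      rw [← prefixPoint_prefixPoint hp hu (Nat.le_add_right r j) (c i), ← hjj', hj,
        prefixPoint_prefixPoint hp hu (Nat.le_add_right r j)]
    intro i i' hii'
    rcases lt_or_gt_of_ne hii' with h | h
    · exact hmain i i' h
    · exact (hmain i' i h).symm
  · intro i hi
    refine ⟨⟨(g i)⁻¹ * h i, Or.inr (A.cayleyGraph_adj.1 (hgh i (by omega))).2⟩, ?_⟩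
    refine (S.mem_M_iff _ _ _).2 ⟨?_, S.word_mem _, S.word_mem _⟩
    simp [w]
  · exact fun i => ⟨(hw i i.2).1, hgl i i.2, hsub _ _ (hw i i.2).2, hsub _ _ (hgc i i.2)⟩

/-- Without tracks, `n` steps at level `r + n` project to at most `n - 1` steps at level `r`. -/
theorem levelDistLE_contract (hp : S.IsPrefixClosed) (hu : S.HasUniqueness)
    {n : ℕ} (hT : ¬ ∃ T : Fin n → Fin (n + 1) → G, S.IsTracks n T) (r : ℕ)
    {c : ℕ → G} (hc : ∀ k < n, (S.levelGraph (r + n)).Adj (c k) (c (k + 1))) :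
    S.LevelDistLE r (n - 1) (S.prefixPoint r (c 0)) (S.prefixPoint r (c n)) := by
  rcases Nat.eq_zero_or_pos r with rfl | hr
  · -- all words start at the identity
    exact LevelDistLE.refl _ _ _
  obtain ⟨i, j, hij, hj, heq⟩ : ∃ i j, i < j ∧ j < n ∧
      S.prefixPoint r (c i) = S.prefixPoint r (c j) := by
    by_contra! h
    exact hT (exists_isTracks_of_injective hp hu hr hc h)
  have h1 := levelDistLE_of_adj_seq hp hu (Nat.le_add_right r n) (Nat.zero_le i)
    fun k _ hk' => hc k (by omega)
  have h2 := levelDistLE_of_adj_seq hp hu (Nat.le_add_right r n) hj.le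
    fun k _ hk' => hc k hk'
  rw [heq] at h1
  exact (h1.trans h2).mono (by omega)

theorem levelDistLE_sub_div (hp : S.IsPrefixClosed) (hu : S.HasUniqueness)
    {n : ℕ} (hn : 0 < n)
    (hT : ¬ ∃ T : Fin n → Fin (n + 1) → G, S.IsTracks n T) (r N : ℕ) {c : ℕ → G}
    (hc : ∀ k < N, (S.levelGraph (r + n)).Adj (c k) (c (k + 1))) :
    S.LevelDistLE r (N - N / n) (S.prefixPoint r (c 0)) (S.prefixPoint r (c N)) := by
  induction N using Nat.strong_induction_on generalizing c with
  | _ N ih =>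
    rcases lt_or_ge N n with h | h
    · rw [Nat.div_eq_of_lt h]
      exact levelDistLE_of_adj_seq hp hu (Nat.le_add_right r n) (Nat.zero_le N)
        fun k _ hk => hc k hk
    · have h1 := levelDistLE_contract hp hu hT r (c := c) fun k hk => hc k (by omega)
      have h2 := ih (N - n) (by omega) (c := fun k => c (n + k)) fun k hk => hc (n + k) (by omega)
      simp only [add_zero, Nat.add_sub_of_le h] at h2
      have h3 := Nat.div_eq_sub_div hn h
      have h4 := Nat.div_le_self (N - n) n
      exact (h1.trans h2).mono (by omega)

theorem levelDistLE_iterate (hp : S.IsPrefixClosed) (hu : S.HasUniqueness)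
    {n : ℕ} (hn : 0 < n)
    (hT : ¬ ∃ T : Fin n → Fin (n + 1) → G, S.IsTracks n T) (r j N : ℕ) {u v : G}
    (h : S.LevelDistLE (r + j * n) N (S.prefixPoint (r + j * n) u) (S.prefixPoint (r + j * n) v)) :
    S.LevelDistLE r ((fun N => N - N / n)^[j] N) (S.prefixPoint r u) (S.prefixPoint r v) := by
  induction j generalizing N with
  | zero => simpa using h
  | succ j ih =>
    obtain ⟨p, hpN⟩ := h
    have h1 : ∀ k < p.length, (S.levelGraph (r + j * n + n)).Adj (p.getVert k)
        (p.getVert (k + 1)) := by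
      intro k hk
      rw [show r + j * n + n = r + (j + 1) * n by ring]
      exact p.adj_getVert_succ hk
    have h2 := levelDistLE_sub_div hp hu hn hT _ _ h1
    have hle : r + j * n ≤ r + (j + 1) * n := by
      rw [add_mul]
      omega
    rw [p.getVert_zero, p.getVert_length, prefixPoint_prefixPoint hp hu hle,
      prefixPoint_prefixPoint hp hu hle] at h2
    refine ih _ (h2.mono (show _ ≤ N - N / n from ?_))
    have h4 : p.length + N / n ≤ N + p.length / n := by
      have := Nat.div_le_div_right (c := n) hpN
      have h5 : N / n ≤ p.length / n + (N - p.length) := by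
        calc N / n = (p.length + (N - p.length)) / n := by rw [Nat.add_sub_of_le hpN]
          _ ≤ (p.length + (N - p.length) * n) / n := by
            refine Nat.div_le_div_right (Nat.add_le_add_left ?_ _)
            exact Nat.le_mul_of_pos_right _ hn
          _ = _ := Nat.add_mul_div_right _ _ hn
      omega
    have h6 := Nat.div_le_self N n
    omega

/-- The iterates of `N ↦ N - N / n` decay like `(1 - 1 / n) ^ j * N`, up to the constant `n`. -/
theorem exists_mul_iterate_sub_div_le {n : ℕ} (hn : 0 < n) (q : ℕ) :
    ∃ j C : ℕ, ∀ N : ℕ, q * (fun N => N - N / n)^[j] N ≤ N + C := by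
  have hn' : (0 : ℝ) < n := by exact_mod_cast hn
  have hn1 : (1 : ℝ) ≤ n := by exact_mod_cast hn
  have hρ0 : (0 : ℝ) ≤ 1 - 1 / n := by
    rw [sub_nonneg, div_le_one hn']
    exact hn1
  have hρ1 : (1 : ℝ) - 1 / n < 1 := by
    have : (0 : ℝ) < 1 / n := by positivity
    linarith
  have hstep : ∀ N : ℕ, ((N - N / n : ℕ) : ℝ) ≤ (1 - 1 / n) * N + 1 := by
    intro N
    rw [Nat.cast_sub (Nat.div_le_self N n)]
    have h1 := Nat.lt_div_mul_add (a := N) hn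
    have h2 : (N : ℝ) < (N / n : ℕ) * n + n := by exact_mod_cast h1
    have h3 : (N : ℝ) / n < (N / n : ℕ) + 1 := by
      rw [div_lt_iff₀ hn']
      linarith
    have h4 : (1 - 1 / (n : ℝ)) * N = N - N / n := by ring
    linarith
  have hiter : ∀ j N : ℕ, (((fun N => N - N / n)^[j] N : ℕ) : ℝ) ≤ (1 - 1 / n) ^ j * N + n := by
    intro j N
    induction j with
    | zero => simp
    | succ j ih =>
      rw [Function.iterate_succ_apply']
      refine (hstep _).trans ?_
      have h1 := mul_le_mul_of_nonneg_left ih hρ0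
      have h2 : (1 - 1 / (n : ℝ)) * ((1 - 1 / n) ^ j * N + n) =
          (1 - 1 / n) ^ (j + 1) * N + (n - 1) := by
        rw [mul_add, ← mul_assoc, ← pow_succ']
        congr 1
        field_simp
      linarith
  obtain ⟨j, hj⟩ := exists_pow_lt_of_lt_one (show (0 : ℝ) < 1 / (q + 1) by positivity) hρ1
  refine ⟨j, q * n, fun N => ?_⟩
  have hq : (q : ℝ) * (1 - 1 / n) ^ j ≤ 1 := by
    rw [lt_div_iff₀ (by positivity)] at hj
    have := pow_nonneg hρ0 j
    linarith
  have h1 := mul_le_mul_of_nonneg_left (hiter j N) (Nat.cast_nonneg (α := ℝ) q)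
  have h2 := mul_le_mul_of_nonneg_right hq (Nat.cast_nonneg (α := ℝ) N)
  have h3 : ((q * (fun N => N - N / n)^[j] N : ℕ) : ℝ) ≤ ((N + q * n : ℕ) : ℝ) := by
    push_cast
    linarith
  exact_mod_cast h3

theorem levelDistLE_of_walk {t : ℕ} {u v : G} (p : A.cayleyGraph.Walk u v)
    (h : ∀ x ∈ p.support, t ≤ (S.word x).length) :
    S.LevelDistLE t p.length (S.prefixPoint t u) (S.prefixPoint t v) := by
  induction p with
  | nil => exact LevelDistLE.refl _ _ _
  | cons ha p ih =>
    simp only [SimpleGraph.Walk.support_cons, List.mem_cons, forall_eq_or_imp] at h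
    rw [SimpleGraph.Walk.length_cons, add_comm]
    exact (levelDistLE_one_of_adj ha h.1 (h.2 _ p.start_mem_support)).trans (ih h.2)

theorem exists_dist_le_of_levelDistLE : ∃ k : ℕ, ∀ (t N : ℕ) (x y : G),
    S.LevelDistLE t N x y → A.cayleyGraph.dist x y ≤ k * N := by
  obtain ⟨k, hk⟩ := exists_dist_prefixPoint_le (S := S)
  have hwalk : ∀ (t : ℕ) (x y : G) (p : (S.levelGraph t).Walk x y),
      A.cayleyGraph.dist x y ≤ k * p.length := by
    intro t x y p
    induction p with
    | nil => simp
    | cons ha p ih =>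
      obtain ⟨-, g, h, hgh, hg, hh, hx, hy⟩ := id ha
      have h1 := hk g h t hgh hg hh
      rw [hx, hy] at h1
      rw [SimpleGraph.Walk.length_cons, mul_add, mul_one, add_comm]
      exact A.cayleyGraph_connected.dist_triangle.trans (Nat.add_le_add h1 ih)
  exact ⟨k, fun t N x y ⟨p, hp⟩ => (hwalk t x y p).trans (Nat.mul_le_mul_left k hp)⟩

/-- Without tracks, a walk outside a ball contracts exponentially under projection towards the
centre of the ball along accepted words, so the Cayley graph has superlinear divergence. -/
theorem hasSuperlinearDivergence (hg : S.IsWeaklyGeodesic) (hp : S.IsPrefixClosed) (hu : S.HasUniqueness)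
    {n : ℕ} (hn : 0 < n)
    (hT : ¬ ∃ T : Fin n → Fin (n + 1) → G, S.IsTracks n T) :
    HasSuperlinearDivergence A.cayleyGraph := by
  intro q
  obtain ⟨k, hk⟩ := exists_dist_le_of_levelDistLE (S := S)
  obtain ⟨j, C, hj⟩ := exists_mul_iterate_sub_div_le hn (q * k)
  refine ⟨j * n, C, fun o u v t N ⟨p, hpN, hps⟩ => ?_⟩
  have hdist : ∀ x, A.cayleyGraph.dist o x = A.cayleyGraph.dist 1 (o⁻¹ * x) := fun x => by
    rw [← A.dist_mul_left o⁻¹ o x, inv_mul_cancel]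
  have h1 := levelDistLE_of_walk (S := S) (t := t + j * n) (p.map (A.mulLeftHom o⁻¹)) (by
    intro x hx
    rw [SimpleGraph.Walk.support_map, List.mem_map] at hx
    obtain ⟨y, hy, rfl⟩ := hx
    rw [length_word hg]
    exact (hps y hy).trans_eq (hdist y))
  rw [SimpleGraph.Walk.length_map] at h1
  have h2 := hk _ _ _ _ (levelDistLE_iterate hp hu hn hT t j N (h1.mono hpN))
  change A.cayleyGraph.dist (S.prefixPoint t (o⁻¹ * u)) (S.prefixPoint t (o⁻¹ * v)) ≤ _ at h2
  have h3 := hj N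
  have hou := hps u p.start_mem_support
  have hov := hps v p.end_mem_support
  have d1 := dist_prefixPoint_le hg t (o⁻¹ * u)
  have d2 := dist_prefixPoint_le hg t (o⁻¹ * v)
  have hΓ := A.cayleyGraph_connected
  have d3 := hΓ.dist_triangle (u := o⁻¹ * u) (v := S.prefixPoint t (o⁻¹ * u)) (w := o⁻¹ * v)
  have d4 := hΓ.dist_triangle (u := S.prefixPoint t (o⁻¹ * u))
    (v := S.prefixPoint t (o⁻¹ * v)) (w := o⁻¹ * v)
  rw [A.dist_mul_left] at d3
  rw [SimpleGraph.dist_comm] at d1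
  rw [← hdist] at d1 d2
  generalize (fun N => N - N / n)^[j] N = N' at h2 h3
  have d5 : A.cayleyGraph.dist u v + 2 * t ≤
      A.cayleyGraph.dist o u + A.cayleyGraph.dist o v + k * N' := by omega
  calc q * (A.cayleyGraph.dist u v + 2 * t)
      ≤ q * (A.cayleyGraph.dist o u + A.cayleyGraph.dist o v + k * N') :=
        Nat.mul_le_mul_left _ d5
    _ = q * (A.cayleyGraph.dist o u + A.cayleyGraph.dist o v) + q * k * N' := by ring
    _ ≤ _ := by omega

end AutomaticStructure

theorem theorem3p1 {G : Type*} [Group G] (A : GeneratingSet G) (S : AutomaticStructure A)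
    (hgeod : S.IsWeaklyGeodesic) (hprefix : S.IsPrefixClosed) (hunique : S.HasUniqueness)
    (hhyp : ¬ A.IsWordHyperbolic) (n : ℕ) (hn : 0 < n) :
    ∃ T : Fin n → Fin (n + 1) → G, S.IsTracks n T := by
  by_contra hT
  exact hhyp ((AutomaticStructure.hasSuperlinearDivergence hgeod hprefix hunique hn
    hT).isHyperbolicSpace A.cayleyGraph_connected)
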